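/- A rooted tree on $[n]=\{1,\dots,n\}$ is a labelled tree with node set $[n]$ together with an arbitrary distinguished node, its root. A node is a record if its label is the largest among the labels on the unique path joining it to the root (so the root is a record). Deleting every edge that joins a record to its parent yields a rooted forest; order its trees $B_1,\dots,B_k$ increasingly according to the labels of their roots. The bonsai type of the rooted tree is the sequence $(|B_1|,\dots,|B_k|)$ of the numbers of nodes of these trees. Lemma. Let $n\ge 1$ and let $t=(t_1,\dots,t_k)$ be a composition of $n$, that is, a sequence of positive integers with sum $n$. The number of rooted trees on $[n]$ with bonsai type $t$ is $$\frac1n\binom{n}{t_1,t_2,\dots,t_k}\,t_1^{t_1-1}t_2^{t_2-1}\cdots t_k^{t_k-1}.$$ In particular, this number does not depend on the order of the parts of $t$: two compositions of $n$ with the same multiset of parts give the same number. -/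

import Mathlib

/-- A rooted tree whose set of nodes is `V`. A rooted tree labelled with `[n]` is a
`RootedLabelledTree (Fin n)`; only the order of the labels matters. -/
@[ext]
structure RootedLabelledTree (V : Type*) where
  /-- the underlying unrooted tree -/
  graph : SimpleGraph V
  isTree : graph.IsTree
  /-- the root, an arbitrary node -/
  root : V

namespace RootedLabelledTree

/-- `v` is a record: its label is the largest along the (unique) path from `v` to the root.
In particular the root is a record. -/
def IsRecord {V : Type*} [LinearOrder V] (T : RootedLabelledTree V) (v : V) : Prop :=
  ∀ q : T.graph.Walk v T.root, q.IsPath → ∀ u ∈ q.support, u ≤ v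

/-- `p` is the parent of `v`: the neighbour of `v` on the (unique) path from `v` to the root.
The root has no parent. -/
def IsParent {V : Type*} (T : RootedLabelledTree V) (p v : V) : Prop :=
  T.graph.Adj p v ∧ ∀ q : T.graph.Walk v T.root, q.IsPath → p ∈ q.support

/-- The forest obtained from `T` by deleting all edges that connect a record to its parent. -/
def bonsaiForest {V : Type*} [LinearOrder V] (T : RootedLabelledTree V) : SimpleGraph V :=
  T.graph.deleteEdges {e | ∃ p v, T.IsRecord v ∧ T.IsParent p v ∧ e = s(p, v)}

/-- `r` is the root of its tree in the rooted forest obtained from `T` by deleting the edges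
above records: it has no parent in that forest. -/
def IsBonsaiRoot {V : Type*} [LinearOrder V] (T : RootedLabelledTree V) (r : V) : Prop :=
  ∀ p, T.IsParent p r → ¬ T.bonsaiForest.Adj p r

open Classical in
/-- The bonsai sequence of `T`: the trees (connected components) of the bonsai forest, each
given together with its root, ordered increasingly according to the labels of their roots. -/
noncomputable def bonsaiSequence {V : Type*} [Fintype V] [LinearOrder V] (T : RootedLabelledTree V) :
    List (V × T.bonsaiForest.ConnectedComponent) :=
  ((Finset.univ.filter T.IsBonsaiRoot).sort (· ≤ ·)).map
    (fun r => (r, T.bonsaiForest.connectedComponentMk r))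

/-- The bonsai type of `T`: the sequence of the numbers of nodes of its bonsais. -/
noncomputable def bonsaiType {V : Type*} [Fintype V] [LinearOrder V] (T : RootedLabelledTree V) :
    List ℕ :=
  T.bonsaiSequence.map (fun B => B.2.supp.ncard)

end RootedLabelledTree

/-- The number of rooted trees labelled with `[n]` with bonsai type `t`. -/
noncomputable def numRootedTreesOfType {n : ℕ} (t : Composition n) : ℕ :=
  {T : RootedLabelledTree (Fin n) | T.bonsaiType = t.blocks}.ncard

/-! Encode a rooted tree by its parent map, the root being a fixed point. Records are then the nodes
that are maximal in their orbit, and the bonsai of a record `r` is the set of nodes whose orbit has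
maximum `r`; `bonsaiType_toTree` and `ncard_bonsaiType` carry this translation. The largest label
`m` is always a record, and its bonsai is its whole set `S` of descendants, listed last. If `m` is
not the root, cutting the edge above `m` leaves a tree on `S` rooted at `m`, a rooted tree on the
complement with the remaining type, and a free attaching node (`mapType_glue`). Hence the count for
`l ++ [s]` is `C(n-1, s-1) * s^(s-2) * (n-s)` times the count for `l`. The factor `n-s` cancels the
`1/(n-s)` in the formula for `l`, so induction on the last part gives the result. The factor
`s^(s-2)` is Cayley's formula, obtained from the same cut with the type ignored; its recursion is
solved by Abel's binomial identity. -/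

/-! ### Abel's binomial identity -/

open Polynomial in
/-- Abel's binomial identity, as an identity of polynomials. -/
theorem abel_polynomial_identity (n : ℕ) (a : ℚ) :
    ∑ k ∈ Finset.range (n + 1),
        C ((n.choose k : ℚ) * ((k : ℚ) + 1) ^ (k - 1)) * (X + C (a + n - k)) ^ (n - k) =
      (X + C (a + n + 1)) ^ n := by
  induction n generalizing a with
  | zero => simp
  | succ n ih =>
    -- Differentiating the identity for `n + 1` at `a` gives `n + 1` times the identity for `n` at
    -- `a + 1`, so the two sides differ by a constant.
    have hder : derivative (∑ k ∈ Finset.range (n + 1 + 1),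
        C (((n + 1).choose k : ℚ) * ((k : ℚ) + 1) ^ (k - 1)) *
          (X + C (a + (n + 1 : ℕ) - k)) ^ (n + 1 - k)) =
        derivative ((X + C (a + (n + 1 : ℕ) + 1)) ^ (n + 1)) := by
      rw [derivative_sum, Finset.sum_range_succ, derivative_X_add_C_pow]
      have h := ih (a + 1)
      have e : a + (n + 1 : ℕ) + 1 = a + 1 + n + 1 := by push_cast; ring
      rw [e, Nat.add_sub_cancel, ← h, Finset.mul_sum]
      simp only [Nat.sub_self, pow_zero, mul_one, derivative_C, add_zero]
      refine Finset.sum_congr rfl fun k hk => ?_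
      have hk' : k ≤ n := Nat.lt_succ_iff.1 (Finset.mem_range.1 hk)
      have e1 : n + 1 - k = (n - k) + 1 := by omega
      rw [derivative_C_mul, derivative_X_add_C_pow, e1, Nat.add_sub_cancel]
      have e2 : a + (n + 1 : ℕ) - k = a + 1 + n - k := by push_cast; ring
      rw [e2, ← mul_assoc, ← mul_assoc]
      congr 1
      have e3 : ((n + 1).choose k : ℚ) * ((n - k : ℕ) + 1) = (n + 1) * n.choose k := by
        have := Nat.choose_mul_succ_eq n k
        rw [e1] at this
        exact_mod_cast this.symm.trans (mul_comm _ _)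
      rw [← C_mul, ← C_mul]
      congr 1
      push_cast
      linear_combination ((k : ℚ) + 1) ^ (k - 1) * e3
    have hconst := derivative_eq_zero
      (p := (∑ k ∈ Finset.range (n + 1 + 1),
        C (((n + 1).choose k : ℚ) * ((k : ℚ) + 1) ^ (k - 1)) *
          (X + C (a + (n + 1 : ℕ) - k)) ^ (n + 1 - k)) - (X + C (a + (n + 1 : ℕ) + 1)) ^ (n + 1)) |>.1
      (by rw [derivative_sub, hder, sub_self])
    rw [natDegree_eq_zero] at hconst
    obtain ⟨c, hc⟩ := hconst
    rw [← sub_eq_zero, ← hc]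
    -- At this root of the right side each base on the left becomes `-(k + 1)`. The powers merge
    -- into an alternating sum of `(k + 1) ^ n`, an `(n + 1)`-st difference of `x ^ n` at `1`, which
    -- vanishes.
    have hev := congrArg (eval (-(a + (n + 1 : ℕ) + 1))) hc
    rw [eval_C, eval_sub, eval_finsetSum] at hev
    rw [hev]
    simp only [eval_mul, eval_C, eval_pow, eval_add, eval_X, neg_add_cancel]
    have hfd := congrFun (fwdDiff_iter_pow_eq_zero_of_lt (R := ℚ) (Nat.lt_succ_self n)) 1
    rw [fwdDiff_iter_eq_sum_shift] at hfd
    rw [zero_pow (Nat.succ_ne_zero n), sub_zero, ← C_0]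
    congr 1
    refine Eq.trans (Finset.sum_congr rfl fun k hk => ?_) hfd
    have hk' : k ≤ n + 1 := Nat.lt_succ_iff.1 (Finset.mem_range.1 hk)
    have e4 : -(a + (n + 1 : ℕ) + 1) + (a + (n + 1 : ℕ) - k) = (-1 : ℚ) * (k + 1) := by ring
    rw [e4, mul_pow]
    have e5 : ((k : ℚ) + 1) ^ (k - 1) * ((k : ℚ) + 1) ^ (n + 1 - k) = (k + 1) ^ n := by
      rcases Nat.eq_zero_or_pos k with rfl | hk0
      · simp
      · rw [← pow_add]; congr 1; omega
    simp only [nsmul_eq_mul, mul_one, zsmul_eq_mul]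
    push_cast
    rw [add_comm (1 : ℚ), ← e5]
    ring

/-- The instance of Abel's binomial identity that counts trees. -/
theorem abel_sum (m : ℕ) :
    ∑ j ∈ Finset.range (m + 1), m.choose j * (j + 1) ^ (j - 1) * (m - j) ^ (m - j) =
      (m + 1) ^ m := by
  have h := congrArg (Polynomial.eval 0) (abel_polynomial_identity m 0)
  simp only [Polynomial.eval_finsetSum, Polynomial.eval_mul, Polynomial.eval_C,
    Polynomial.eval_pow, Polynomial.eval_add, Polynomial.eval_X, zero_add] at h
  have h' : ((∑ j ∈ Finset.range (m + 1), m.choose j * (j + 1) ^ (j - 1) * (m - j) ^ (m - j) : ℕ)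
      : ℚ) = ((m + 1) ^ m : ℕ) := by
    push_cast
    rw [← h]
    refine Finset.sum_congr rfl fun k hk => ?_
    rw [Nat.cast_sub (Nat.lt_succ_iff.1 (Finset.mem_range.1 hk))]
  exact_mod_cast h'

/-! ### Rooted trees as parent maps -/

/-- `f` is the parent map of a rooted tree with root `r`; the root is sent to itself. -/
def IsRootedAt {V : Type*} (f : V → V) (r : V) : Prop :=
  f r = r ∧ ∀ v, ∃ k, f^[k] v = r

namespace IsRootedAt

variable {V : Type*} {f : V → V} {r : V}

theorem iterate_root (h : IsRootedAt f r) (k : ℕ) : f^[k] r = r :=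
  Function.iterate_fixed h.1 k

/-- Going round the cycle often enough passes through the root, which is absorbing. -/
theorem eq_root_of_iterate_eq (h : IsRootedAt f r) {v : V} {k : ℕ} (hk : 0 < k)
    (hv : f^[k] v = v) : v = r := by
  obtain ⟨j, hj⟩ := h.2 v
  have hp : Function.IsPeriodicPt f (k * j) v := Function.IsPeriodicPt.mul_const hv j
  obtain ⟨i, hi⟩ := Nat.exists_eq_add_of_le' (Nat.le_mul_of_pos_left j hk)
  rw [← hp.eq, hi, Function.iterate_add_apply, hj, h.iterate_root]

theorem root_unique (h : IsRootedAt f r) {r' : V} (h' : IsRootedAt f r') : r' = r :=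
  h.eq_root_of_iterate_eq one_pos h'.1

theorem conj (h : IsRootedAt f r) {W : Type*} (e : V ≃ W) :
    IsRootedAt (e ∘ f ∘ e.symm) (e r) := by
  have hs : Function.Semiconj e f (e ∘ f ∘ e.symm) := fun v => by simp
  refine ⟨by simp [h.1], fun w => ?_⟩
  obtain ⟨k, hk⟩ := h.2 (e.symm w)
  refine ⟨k, ?_⟩
  have := (hs.iterate_right k) (e.symm w)
  rw [hk, e.apply_symm_apply] at this
  exact this.symm

end IsRootedAt

/-! ### Cutting and joining at the edge above a node -/

section Glue

variable {V : Type*}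

open Classical in
/-- Join a parent map `g` on `S` and a parent map `f` on the complement of `S` by making `p` the
parent of `m`. -/
noncomputable def glue (m : V) (S : Finset V) (g : S → S) (f : {x // x ∉ S} → {x // x ∉ S})
    (p : {x // x ∉ S}) : V → V :=
  fun v => if h : v ∈ S then if v = m then p else g ⟨v, h⟩ else f ⟨v, h⟩

variable {m : V} {S : Finset V} {g : S → S} {f : {x // x ∉ S} → {x // x ∉ S}} {p : {x // x ∉ S}}

theorem glue_self (hm : m ∈ S) : glue m S g f p m = p := by simp [glue, hm]

theorem glue_of_mem {v : V} (hv : v ∈ S) (hvm : v ≠ m) : glue m S g f p v = g ⟨v, hv⟩ := by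
  simp [glue, hv, hvm]

theorem glue_of_notMem {v : V} (hv : v ∉ S) : glue m S g f p v = f ⟨v, hv⟩ := by
  simp [glue, hv]

theorem glue_iterate_coe (k : ℕ) (v : {x // x ∉ S}) :
    (glue m S g f p)^[k] v = (f^[k] v : {x // x ∉ S}) := by
  have hs : Function.Semiconj ((↑) : {x // x ∉ S} → V) f (glue m S g f p) :=
    fun v => (glue_of_notMem v.2).symm
  exact ((hs.iterate_right k) v).symm

theorem exists_glue_iterate_eq (hm : m ∈ S) (k : ℕ) (v : S) (hk : g^[k] v = ⟨m, hm⟩) :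
    ∃ j, (glue m S g f p)^[j] v = m := by
  induction k generalizing v with
  | zero => exact ⟨0, congrArg Subtype.val hk⟩
  | succ k ih =>
    by_cases hv : (v : V) = m
    · exact ⟨0, hv⟩
    · obtain ⟨j, hj⟩ := ih (g v) hk
      exact ⟨j + 1, by rw [Function.iterate_succ_apply, glue_of_mem v.2 hv]; exact hj⟩

/-- The set `S` is recovered from the glued map as the set of descendants of `m`. -/
theorem exists_glue_iterate_eq_iff (hm : m ∈ S) (hg : IsRootedAt g ⟨m, hm⟩) (v : V) :
    (∃ j, (glue m S g f p)^[j] v = m) ↔ v ∈ S := by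
  constructor
  · rintro ⟨j, hj⟩
    by_contra hv
    have := glue_iterate_coe (m := m) (g := g) (f := f) (p := p) j ⟨v, hv⟩
    rw [hj] at this
    exact (f^[j] ⟨v, hv⟩).2 (this ▸ hm)
  · intro hv
    obtain ⟨k, hk⟩ := hg.2 ⟨v, hv⟩
    exact exists_glue_iterate_eq hm k ⟨v, hv⟩ hk

theorem IsRootedAt.glue (hm : m ∈ S) (hg : IsRootedAt g ⟨m, hm⟩) {r : {x // x ∉ S}}
    (hf : IsRootedAt f r) : IsRootedAt (glue m S g f p) r := by
  refine ⟨by rw [glue_of_notMem r.2, Subtype.coe_eta, hf.1], fun v => ?_⟩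
  by_cases hv : v ∈ S
  · obtain ⟨j, hj⟩ := (exists_glue_iterate_eq_iff (f := f) (p := p) hm hg v).2 hv
    obtain ⟨k, hk⟩ := hf.2 p
    refine ⟨k + 1 + j, ?_⟩
    rw [Function.iterate_add_apply, hj, Function.iterate_succ_apply, glue_self hm,
      glue_iterate_coe, hk]
  · obtain ⟨k, hk⟩ := hf.2 ⟨v, hv⟩
    exact ⟨k, by rw [← hk, ← glue_iterate_coe]⟩

/-- The inverse of gluing. The parent of `m` is outside `S`, since otherwise `m` would lie on a
cycle and be the root. -/
theorem IsRootedAt.exists_glue {F : V → V} {r : V} (hF : IsRootedAt F r) (hr : r ≠ m)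
    (hS : ∀ v, v ∈ S ↔ ∃ k, F^[k] v = m) :
    ∃ g : S → S, ∃ f : {x // x ∉ S} → {x // x ∉ S}, ∃ p,
      (∃ hm : m ∈ S, IsRootedAt g ⟨m, hm⟩) ∧ (∃ r', IsRootedAt f r') ∧ _root_.glue m S g f p = F := by
  classical
  have hm : m ∈ S := (hS m).2 ⟨0, rfl⟩
  have hp : F m ∉ S := fun h => by
    obtain ⟨k, hk⟩ := (hS _).1 h
    exact hr (hF.eq_root_of_iterate_eq (Nat.succ_pos k) hk).symm
  have hrS : r ∉ S := fun h => by
    obtain ⟨k, hk⟩ := (hS _).1 h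
    exact hr ((hF.iterate_root k).symm.trans hk)
  have hmem : ∀ v, v ∈ S → v ≠ m → F v ∈ S := fun v hv hvm => by
    obtain ⟨k, hk⟩ := (hS _).1 hv
    cases k with
    | zero => exact absurd hk hvm
    | succ k => exact (hS _).2 ⟨k, hk⟩
  have hnot : ∀ v, v ∉ S → F v ∉ S := fun v hv h => by
    obtain ⟨k, hk⟩ := (hS _).1 h
    exact hv ((hS _).2 ⟨k + 1, hk⟩)
  let g : S → S := fun v => if h : (v : V) = m then v else ⟨F v, hmem v v.2 h⟩
  let f : {x // x ∉ S} → {x // x ∉ S} := fun v => ⟨F v, hnot v v.2⟩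
  have hgk : ∀ k (v : S), F^[k] v = m → ∃ j, g^[j] v = ⟨m, hm⟩ := by
    intro k
    induction k with
    | zero => exact fun v hv => ⟨0, Subtype.ext hv⟩
    | succ k ih =>
      intro v hv
      by_cases h : (v : V) = m
      · exact ⟨0, Subtype.ext h⟩
      · obtain ⟨j, hj⟩ := ih ⟨F v, hmem v v.2 h⟩ hv
        refine ⟨j + 1, ?_⟩
        rw [Function.iterate_succ_apply, ← hj]
        simp [g, h]
  have hs : Function.Semiconj ((↑) : {x // x ∉ S} → V) f F := fun v => rfl
  refine ⟨g, f, ⟨F m, hp⟩, ⟨hm, by simp [g], fun v => ?_⟩, ⟨⟨r, hrS⟩, Subtype.ext hF.1,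
    fun v => ?_⟩, ?_⟩
  · obtain ⟨k, hk⟩ := (hS _).1 v.2
    exact hgk k v hk
  · obtain ⟨k, hk⟩ := hF.2 v
    exact ⟨k, Subtype.ext (((hs.iterate_right k) v).trans hk)⟩
  · funext v
    by_cases hv : v ∈ S
    · by_cases h : v = m
      · subst h; rw [glue_self hm]
      · rw [glue_of_mem hv h]; simp [g, h]
    · rw [glue_of_notMem hv]

/-- Gluing forgets the value of `g` at `m`; the fixed-point hypotheses restore it. -/
theorem glue_injective (hm : m ∈ S) {g' : S → S} {f' : {x // x ∉ S} → {x // x ∉ S}}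
    {p' : {x // x ∉ S}} (hg : g ⟨m, hm⟩ = ⟨m, hm⟩) (hg' : g' ⟨m, hm⟩ = ⟨m, hm⟩)
    (h : glue m S g f p = glue m S g' f' p') : g = g' ∧ f = f' ∧ p = p' := by
  refine ⟨funext fun v => ?_, funext fun v => Subtype.ext ?_, Subtype.ext ?_⟩
  · by_cases hv : (v : V) = m
    · obtain rfl : v = ⟨m, hm⟩ := Subtype.ext hv
      rw [hg, hg']
    · have := congrFun h v
      rw [glue_of_mem v.2 hv, glue_of_mem v.2 hv] at this
      exact Subtype.ext this
  · have := congrFun h v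
    rwa [glue_of_notMem v.2, glue_of_notMem v.2] at this
  · have := congrFun h m
    rwa [glue_self hm, glue_self hm] at this

end Glue

/-! ### Recursive counting and Cayley's formula -/

section Count

theorem sum_filter_mem_card {V : Type*} [Fintype V] [DecidableEq V] (m : V) (F : ℕ → ℕ) :
    ∑ S : Finset V with m ∈ S, F S.card =
      ∑ j ∈ Finset.range (Fintype.card V), (Fintype.card V - 1).choose j * F (j + 1) := by
  have hc : (Finset.univ.erase m).card = Fintype.card V - 1 := by simp
  have h := Finset.sum_powerset_apply_card (fun j => F (j + 1)) (x := Finset.univ.erase m)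
  have hpos : 0 < Fintype.card V := Fintype.card_pos_iff.2 ⟨m⟩
  rw [hc, Nat.sub_add_cancel hpos] at h
  simp only [smul_eq_mul] at h
  rw [← h]
  refine Finset.sum_bij' (fun S _ => S.erase m) (fun T _ => insert m T) ?_ ?_ ?_ ?_ ?_
  · intro S _
    exact Finset.mem_powerset.2 (Finset.erase_subset_erase m (Finset.subset_univ S))
  · intro T _
    simp
  · intro S hS
    exact Finset.insert_erase (Finset.mem_filter.1 hS).2
  · intro T hT
    exact Finset.erase_insert fun h => by simpa using Finset.mem_powerset.1 hT h
  · intro S hS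
    rw [Finset.card_erase_add_one (Finset.mem_filter.1 hS).2]

/-- Counting rooted maps by cutting the edge above a node `m` that is not the root. -/
theorem ncard_rooted_ne {V : Type*} [Fintype V] (m : V) (P : (V → V) → Prop)
    (Q : ∀ S : Finset V, ({x // x ∉ S} → {x // x ∉ S}) → Prop)
    (hPQ : ∀ (S : Finset V) (hm : m ∈ S) (g : S → S) (f : {x // x ∉ S} → {x // x ∉ S}) (p),
      IsRootedAt g ⟨m, hm⟩ → (P (glue m S g f p) ↔ Q S f))
    (a b : ℕ → ℕ)
    (ha : ∀ S : Finset V, S.card < Fintype.card V → ∀ hm : m ∈ S,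
      {g : S → S | IsRootedAt g ⟨m, hm⟩}.ncard = a S.card)
    (hb : ∀ S : Finset V, S.card < Fintype.card V → m ∈ S →
      {f : {x // x ∉ S} → {x // x ∉ S} | (∃ r, IsRootedAt f r) ∧ Q S f}.ncard = b S.card) :
    {F : V → V | (∃ r, r ≠ m ∧ IsRootedAt F r) ∧ P F}.ncard =
      ∑ j ∈ Finset.range (Fintype.card V), (Fintype.card V - 1).choose j *
        (a (j + 1) * b (j + 1) * (Fintype.card V - (j + 1))) := by
  classical
  rw [← sum_filter_mem_card m (fun j => a j * b j * (Fintype.card V - j)),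
    Set.ncard_eq_toFinset_card',
    Finset.card_eq_sum_card_fiberwise (f := fun F => ({v | ∃ k, F^[k] v = m} : Finset V))
      (t := ({S | m ∈ S} : Finset (Finset V)))]
  swap
  · intro F _
    simpa using ⟨0, rfl⟩
  refine Finset.sum_congr rfl fun S hS => ?_
  have hm : m ∈ S := (Finset.mem_filter.1 hS).2
  -- The maps in which `m` has descendant set `S` are exactly the gluings along `S`.
  have himg : (({F ∈ {F : V → V | (∃ r, r ≠ m ∧ IsRootedAt F r) ∧ P F}.toFinset |
      ({v | ∃ k, F^[k] v = m} : Finset V) = S} : Finset (V → V)) : Set (V → V)) =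
      (fun x : (S → S) × ({x // x ∉ S} → {x // x ∉ S}) × {x // x ∉ S} =>
        glue m S x.1 x.2.1 x.2.2) ''
      ({g : S → S | IsRootedAt g ⟨m, hm⟩} ×ˢ
        {f : {x // x ∉ S} → {x // x ∉ S} | (∃ r, IsRootedAt f r) ∧ Q S f} ×ˢ Set.univ) := by
    ext F
    simp only [Finset.coe_filter, Set.mem_toFinset, Set.mem_ofPred_eq, Set.mem_image, Set.mem_prod,
      Set.mem_univ, and_true, Prod.exists]
    constructor
    · rintro ⟨⟨⟨r, hr, hF⟩, hP⟩, hS⟩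
      obtain ⟨g, f, p, ⟨_, hg⟩, hf, rfl⟩ := hF.exists_glue hr (S := S) (by simp [← hS])
      exact ⟨g, f, p, ⟨hg, hf, (hPQ S hm g f p hg).1 hP⟩, rfl⟩
    · rintro ⟨g, f, p, ⟨hg, ⟨r, hf⟩, hQ⟩, rfl⟩
      refine ⟨⟨⟨r, fun h => r.2 (h ▸ hm), hg.glue hm hf⟩, (hPQ S hm g f p hg).2 hQ⟩, ?_⟩
      ext v
      simp [exists_glue_iterate_eq_iff hm hg]
  rw [← Set.ncard_coe_finset, himg, Set.InjOn.ncard_image, Set.ncard_prod, Set.ncard_prod,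
    Set.ncard_univ, Nat.card_eq_fintype_card, Fintype.card_subtype_compl, Fintype.card_coe,
    ← mul_assoc]
  -- If `S` is everything there is no attaching node and both sides vanish. So `ha` and `hb` are
  -- needed only for proper subsets, which is what makes strong induction possible.
  · rcases (Finset.card_le_univ S).lt_or_eq with h | h
    · rw [ha S h hm, hb S h hm]
    · simp [h]
  · rintro ⟨g, f, p⟩ hx ⟨g', f', p'⟩ hx' h
    obtain ⟨rfl, rfl, rfl⟩ := glue_injective hm hx.1.1 hx'.1.1 h
    rfl

theorem ncard_isRootedAt_eq {V : Type*} (r r' : V) :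
    {f : V → V | IsRootedAt f r}.ncard = {f : V → V | IsRootedAt f r'}.ncard := by
  classical
  let e := Equiv.swap r r'
  refine Set.ncard_congr (fun f _ => e ∘ f ∘ e.symm) ?_ ?_ ?_
  · intro f hf
    have := IsRootedAt.conj hf e
    rwa [Equiv.swap_apply_left] at this
  · intro f f' _ _ h
    funext v
    have := congrFun h (e v)
    simpa using this
  · intro f hf
    refine ⟨e.symm ∘ f ∘ e, ?_, by funext v; simp⟩
    have := IsRootedAt.conj hf e.symm
    rwa [Equiv.symm_swap, Equiv.swap_apply_right] at this

theorem ncard_exists_isRootedAt {V : Type*} [Fintype V] (r : V) :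
    {f : V → V | ∃ r, IsRootedAt f r}.ncard =
      Fintype.card V * {f : V → V | IsRootedAt f r}.ncard := by
  classical
  have h : {f : V → V | ∃ r, IsRootedAt f r} = ⋃ r ∈ (Set.univ : Set V), {f | IsRootedAt f r} := by
    ext; simp
  have hd : ((Finset.univ : Finset V) : Set V).PairwiseDisjoint
      fun r => ({f : V → V | IsRootedAt f r} : Set (V → V)).toFinset := by
    intro a _ b _ hab
    rw [Function.onFun, Finset.disjoint_left]
    intro f hf hf'
    simp only [Set.mem_toFinset, Set.mem_ofPred_eq] at hf hf'
    exact hab (hf'.root_unique hf)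
  have hu : ({f : V → V | ∃ r, IsRootedAt f r} : Set (V → V)).toFinset =
      Finset.univ.biUnion fun r => ({f : V → V | IsRootedAt f r} : Set (V → V)).toFinset := by
    ext; simp
  rw [Set.ncard_eq_toFinset_card', hu, Finset.card_biUnion hd]
  simp_rw [← Set.ncard_eq_toFinset_card']
  rw [Finset.sum_congr rfl fun r' _ => ncard_isRootedAt_eq r' r]
  simp

/-- **Cayley's formula**: there are `n ^ (n - 2)` trees on `n` labelled nodes with a given root. -/
theorem ncard_isRootedAt (n : ℕ) : ∀ {V : Type*} [Fintype V] (r : V), Fintype.card V = n →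
    {f : V → V | IsRootedAt f r}.ncard = n ^ (n - 2) := by
  induction n using Nat.strong_induction_on with
  | _ n ih =>
    intro V _ m hn
    classical
    have hpos : 0 < n := hn ▸ Fintype.card_pos_iff.2 ⟨m⟩
    have hne := ncard_rooted_ne m (fun _ => True) (fun _ _ => True) (fun _ _ _ _ _ _ => Iff.rfl)
      (fun j => j ^ (j - 2)) (fun j => (n - j) * (n - j) ^ (n - j - 2))
      (fun S hS hm => ih _ (hn ▸ hS) _ (Fintype.card_coe S))
      (fun S hS hm => by
        have hc : Fintype.card {x // x ∉ S} = n - S.card := by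
          rw [Fintype.card_subtype_compl, Fintype.card_coe, hn]
        have hp : 0 < Fintype.card {x // x ∉ S} := by omega
        obtain ⟨r⟩ := Fintype.card_pos_iff.1 hp
        have hSpos := Finset.card_pos.2 ⟨m, hm⟩
        simp only [and_true]
        rw [ncard_exists_isRootedAt r, ih _ (by omega) r hc, hc])
    simp only [and_true, hn] at hne
    -- With `c` maps rooted at `m` there are `n * c` rooted maps by symmetry, and also `c` plus the
    -- number rooted elsewhere. This determines `(n - 1) * c`.
    have hsplit : {f : V → V | ∃ r, IsRootedAt f r} =
        {f : V → V | IsRootedAt f m} ∪ {f | ∃ r, r ≠ m ∧ IsRootedAt f r} := by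
      ext f
      constructor
      · rintro ⟨r, hr⟩
        by_cases h : r = m
        · exact Or.inl (h ▸ hr)
        · exact Or.inr ⟨r, h, hr⟩
      · rintro (h | ⟨r, -, h⟩)
        exacts [⟨m, h⟩, ⟨r, h⟩]
    have hdisj : Disjoint {f : V → V | IsRootedAt f m} {f | ∃ r, r ≠ m ∧ IsRootedAt f r} := by
      rw [Set.disjoint_left]
      rintro f hf ⟨r, hr, hf'⟩
      exact hr (IsRootedAt.root_unique hf hf')
    have htot := ncard_exists_isRootedAt m
    rw [hsplit, Set.ncard_union_eq hdisj, hne, hn] at htot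
    obtain ⟨k, rfl⟩ := Nat.exists_eq_add_of_le' hpos
    have habel := abel_sum k
    rw [Finset.sum_range_succ] at habel htot
    simp only [Nat.sub_self, pow_zero, mul_one, Nat.choose_self, one_mul, mul_zero, add_zero,
      Nat.add_sub_cancel] at habel htot
    have hsum : ∑ j ∈ Finset.range k, k.choose j * ((j + 1) ^ (j + 1 - 2) *
        ((k + 1 - (j + 1)) * (k + 1 - (j + 1)) ^ (k + 1 - (j + 1) - 2)) * (k + 1 - (j + 1))) =
        ∑ j ∈ Finset.range k, k.choose j * (j + 1) ^ (j - 1) * (k - j) ^ (k - j) := by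
      refine Finset.sum_congr rfl fun j hj => ?_
      have hj' := Finset.mem_range.1 hj
      obtain ⟨d, rfl⟩ := Nat.exists_eq_add_of_lt hj'
      have e1 : j + d + 1 + 1 - (j + 1) = d + 1 := by omega
      have e2 : j + d + 1 - j = d + 1 := by omega
      have e3 : j + 1 - 2 = j - 1 := by omega
      rw [e1, e2, e3]
      cases d with
      | zero => simp
      | succ d =>
        have e4 : d + 1 + 1 - 2 = d := by omega
        rw [e4]
        ring
    rw [hsum] at htot
    -- For `n = 1` the equation for `(n - 1) * c` is void, so this case is direct.
    rcases Nat.eq_zero_or_pos k with rfl | hk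
    · have : Subsingleton V := Fintype.card_le_one_iff_subsingleton.1 (by omega)
      have huniv : {f : V → V | IsRootedAt f m} = {id} := by
        ext f
        refine ⟨fun _ => Subsingleton.elim f id, ?_⟩
        rintro rfl
        exact ⟨rfl, fun v => ⟨0, Subsingleton.elim _ _⟩⟩
      simp [huniv]
    · obtain ⟨i, rfl⟩ := Nat.exists_eq_add_of_le' hk
      have e5 : i + 1 + 1 - 2 = i := by omega
      rw [e5]
      rw [Nat.add_sub_cancel] at habel
      have e6 : (i + 1 + 1) ^ (i + 1) = (i + 1 + 1) ^ i + (i + 1) * (i + 1 + 1) ^ i := by ring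
      have : (i + 1) * {f : V → V | IsRootedAt f m}.ncard = (i + 1) * (i + 1 + 1) ^ i := by
        linarith
      exact Nat.eq_of_mul_eq_mul_left (Nat.succ_pos i) this

end Count

/-! ### Bonsai types of parent maps -/

section MapType

variable {V : Type*} [LinearOrder V]

/-- `v` is the largest element of its orbit under `f`. -/
def IsMapRecord (f : V → V) (v : V) : Prop := ∀ k, f^[k] v ≤ v

/-- `r` is the largest element of the orbit of `v` under `f`. -/
def IsOrbitTop (f : V → V) (v r : V) : Prop := (∃ k, f^[k] v = r) ∧ ∀ k, f^[k] v ≤ r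

/-- The numbers of nodes whose orbit has a given maximum, listed by increasing maxima. -/
noncomputable def mapType [Finite V] (f : V → V) : List ℕ :=
  ((Set.toFinite {r | IsMapRecord f r}).toFinset.sort (· ≤ ·)).map
    fun r => {v | IsOrbitTop f v r}.ncard

/-- A non-record is not the maximum of its own orbit, so dropping it keeps the maximum. Thus the
orbit maximum is constant along the edges that survive in the bonsai forest. -/
theorem isOrbitTop_apply_iff {f : V → V} {u t : V} (hu : ¬ IsMapRecord f u) :
    IsOrbitTop f (f u) t ↔ IsOrbitTop f u t := by
  constructor
  · rintro ⟨⟨k, hk⟩, hle⟩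
    refine ⟨⟨k + 1, hk⟩, ?_⟩
    have hut : u ≤ t := by
      by_contra hlt
      refine hu fun j => ?_
      cases j with
      | zero => exact le_rfl
      | succ j => exact (hle j).trans (not_le.1 hlt).le
    rintro (_ | j)
    exacts [hut, hle j]
  · rintro ⟨⟨k, hk⟩, hle⟩
    refine ⟨?_, fun j => hle (j + 1)⟩
    cases k with
    | zero =>
      obtain rfl : u = t := hk
      exact absurd hle hu
    | succ k => exact ⟨k, hk⟩

variable [Finite V] {m : V}

theorem mapType_of_isRootedAt_max (hmax : ∀ v, v ≤ m) {f : V → V} (hf : IsRootedAt f m) :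
    mapType f = [Nat.card V] := by
  have h1 : (Set.toFinite {r | IsMapRecord f r}).toFinset = {m} := by
    ext r
    rw [Set.Finite.mem_toFinset, Finset.mem_singleton, Set.mem_ofPred_eq]
    constructor
    · intro h
      obtain ⟨k, hk⟩ := hf.2 r
      exact le_antisymm (hmax r) (hk ▸ h k)
    · rintro rfl k
      exact hmax _
  have h2 : {v | IsOrbitTop f v m} = Set.univ :=
    Set.eq_univ_of_forall fun v => ⟨hf.2 v, fun k => hmax _⟩
  rw [mapType, h1, Finset.sort_singleton, List.map_singleton, h2, Set.ncard_univ]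

theorem mapType_ne_nil [Nonempty V] (f : V → V) : mapType f ≠ [] := by
  obtain ⟨m, hmax⟩ := Finite.exists_max (id : V → V)
  rw [mapType, Ne, List.map_eq_nil_iff, ← List.length_eq_zero_iff, Finset.length_sort,
    Finset.card_eq_zero]
  refine Finset.Nonempty.ne_empty ⟨m, ?_⟩
  rw [Set.Finite.mem_toFinset]
  exact fun k => hmax _

/-- Every orbit starting in `S` meets the maximum `m`, so `m` is the only record there and comes
last. Orbits starting outside `S` never enter it and are those of `f`. -/
theorem mapType_glue (hmax : ∀ v, v ≤ m) {S : Finset V} (hm : m ∈ S) {g : S → S}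
    (hg : IsRootedAt g ⟨m, hm⟩) (f : {x // x ∉ S} → {x // x ∉ S}) (p : {x // x ∉ S}) :
    mapType (glue m S g f p) = mapType f ++ [S.card] := by
  have hreach := exists_glue_iterate_eq_iff (f := f) (p := p) hm hg
  have htop : ∀ v, IsOrbitTop (glue m S g f p) v m ↔ v ∈ S := fun v =>
    ⟨fun h => (hreach v).1 h.1, fun h => ⟨(hreach v).2 h, fun k => hmax _⟩⟩
  have hrec : (Set.toFinite {r | IsMapRecord (glue m S g f p) r}).toFinset.sort (· ≤ ·) =
      ((Set.toFinite {r | IsMapRecord f r}).toFinset.sort (· ≤ ·)).map (↑) ++ [m] := by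
    refine List.Perm.eq_of_pairwise' (Finset.pairwise_sort _ _) ?_ ?_ (r := (· ≤ ·))
    · rw [List.pairwise_append]
      refine ⟨List.Pairwise.map _ (fun a b h => h) (Finset.pairwise_sort _ (· ≤ ·)),
        List.pairwise_singleton _ _, fun a _ b hb => ?_⟩
      rw [List.mem_singleton.1 hb]
      exact hmax a
    · refine (List.perm_ext_iff_of_nodup (Finset.sort_nodup _ _) ?_).2 fun v => ?_
      · rw [List.nodup_append]
        refine ⟨(Finset.sort_nodup _ _).map Subtype.val_injective, List.nodup_singleton _, ?_⟩
        rintro a ha b hb rfl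
        obtain ⟨x, -, rfl⟩ := List.mem_map.1 ha
        exact x.2 (List.mem_singleton.1 hb ▸ hm)
      · simp only [Finset.mem_sort, Set.Finite.mem_toFinset, Set.mem_ofPred_eq, List.mem_append,
          List.mem_map, List.mem_singleton]
        constructor
        · intro h
          by_cases hv : v ∈ S
          · obtain ⟨k, hk⟩ := (hreach v).2 hv
            exact Or.inr (le_antisymm (hmax v) (hk ▸ h k))
          · refine Or.inl ⟨⟨v, hv⟩, fun k => ?_, rfl⟩
            have := h k
            rwa [glue_iterate_coe k ⟨v, hv⟩] at this
        · rintro (⟨x, hx, rfl⟩ | rfl)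
          · intro k
            rw [glue_iterate_coe]
            exact hx k
          · exact fun k => hmax _
  rw [mapType, hrec, List.map_append, List.map_map, List.map_singleton, mapType]
  congr 1
  · refine List.map_congr_left fun r _ => ?_
    have himg : {v | IsOrbitTop (glue m S g f p) v r} =
        ((↑) : {x // x ∉ S} → V) '' {v | IsOrbitTop f v r} := by
      ext v
      constructor
      · rintro ⟨⟨k, hk⟩, hle⟩
        have hv : v ∉ S := fun hv => by
          obtain ⟨j, hj⟩ := (hreach v).2 hv
          exact r.2 (le_antisymm (hmax r) (hj ▸ hle j) ▸ hm)
        refine ⟨⟨v, hv⟩, ⟨⟨k, ?_⟩, fun k => ?_⟩, rfl⟩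
        · rw [glue_iterate_coe k ⟨v, hv⟩] at hk
          exact Subtype.ext hk
        · have := hle k
          rwa [glue_iterate_coe k ⟨v, hv⟩] at this
      · rintro ⟨x, ⟨⟨k, hk⟩, hle⟩, rfl⟩
        refine ⟨⟨k, by rw [glue_iterate_coe, hk]⟩, fun k => ?_⟩
        rw [glue_iterate_coe]
        exact hle k
    rw [Function.comp_apply, himg, Set.ncard_image_of_injective _ Subtype.val_injective]
  · have : {v | IsOrbitTop (glue m S g f p) v m} = (S : Set V) := by ext v; exact htop v
    rw [this, Set.ncard_coe_finset]

end MapType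

/-! ### Counting parent maps of a given type -/

open Nat in
/-- The number of rooted maps of a given type. -/
theorem ncard_mapType (l : List ℕ) (hl : l ≠ []) (hpos : ∀ i ∈ l, 0 < i) :
    ∀ {V : Type*} [Fintype V] [LinearOrder V], Fintype.card V = l.sum →
      l.sum * {f : V → V | (∃ r, IsRootedAt f r) ∧ mapType f = l}.ncard * (l.map (· !)).prod =
        l.sum ! * (l.map fun i => i ^ (i - 1)).prod := by
  induction l using List.reverseRecOn with
  | nil => exact absurd rfl hl
  | append_singleton l s ih =>
    intro V _ _ hn
    have hs : 0 < s := hpos s (by simp)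
    have hVpos : 0 < Fintype.card V := by rw [hn]; simp; omega
    obtain ⟨v₀⟩ := Fintype.card_pos_iff.1 hVpos
    obtain ⟨m, hmax⟩ : ∃ m : V, ∀ v, v ≤ m :=
      ⟨Finset.univ.max' ⟨v₀, Finset.mem_univ _⟩, fun v => Finset.le_max' _ _ (Finset.mem_univ v)⟩
    -- A single part means that the root is `m`: otherwise the cut above `m` would show at least two
    -- parts.
    rcases eq_or_ne l [] with rfl | hl'
    · simp only [List.nil_append, List.sum_singleton, List.map_singleton, List.prod_singleton]
        at hn ⊢
      have hset : {f : V → V | (∃ r, IsRootedAt f r) ∧ mapType f = [s]} =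
          {f | IsRootedAt f m} := by
        ext f₀
        constructor
        · rintro ⟨⟨r, hr⟩, ht⟩
          by_cases h : r = m
          · exact h ▸ hr
          · classical
            obtain ⟨g, f, p, ⟨hm, hg⟩, -, hglue⟩ :=
              hr.exists_glue h (S := ({v | ∃ k, f₀^[k] v = m} : Finset V)) (by simp)
            rw [← hglue, mapType_glue hmax hm hg, ← List.nil_append [s]] at ht
            have : Nonempty {x // x ∉ ({v | ∃ k, f₀^[k] v = m} : Finset V)} := ⟨p⟩
            exact absurd (List.append_inj_left' ht rfl) (mapType_ne_nil f)
        · intro h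
          exact ⟨⟨m, h⟩, by rw [mapType_of_isRootedAt_max hmax h, Nat.card_eq_fintype_card, hn]⟩
      rw [hset, ncard_isRootedAt s m hn]
      have e : s * s ^ (s - 2) = s ^ (s - 1) := by
        rcases s with _ | _ | s
        · omega
        · simp
        · rw [← pow_succ']; rfl
      rw [e, mul_comm]
    · have hlpos : ∀ i ∈ l, 0 < i := fun i hi => hpos i (by simp [hi])
      have ih := @ih hl' hlpos
      simp only [List.map_append, List.map_singleton, List.prod_append, List.prod_singleton,
        List.sum_append, List.sum_singleton] at hn ⊢
      classical
      have hq : 0 < l.sum := List.sum_pos l hlpos hl'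
      have hfac : 0 < (l.map (· !)).prod := by
        refine Nat.pos_of_ne_zero fun h => ?_
        obtain ⟨i, -, hi⟩ := List.mem_map.1 (List.prod_eq_zero_iff.1 h)
        exact Nat.factorial_ne_zero i hi
      -- The count on the complement, as a closed expression so that it visibly does not depend on
      -- `S`.
      let N := l.sum ! * (l.map fun i => i ^ (i - 1)).prod / (l.sum * (l.map (· !)).prod)
      have hN : ∀ S : Finset V, S.card = s →
          {f : {x // x ∉ S} → {x // x ∉ S} | (∃ r, IsRootedAt f r) ∧ mapType f = l}.ncard = N ∧
          l.sum * N * (l.map (· !)).prod = l.sum ! * (l.map fun i => i ^ (i - 1)).prod := by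
        intro S hS
        have h := @ih {x // x ∉ S} _ _ (by
          rw [Fintype.card_subtype_compl, Fintype.card_coe, hn, hS, Nat.add_sub_cancel])
        have h' : {f : {x // x ∉ S} → {x // x ∉ S} |
            (∃ r, IsRootedAt f r) ∧ mapType f = l}.ncard = N := by
          refine (Nat.div_eq_of_eq_mul_right (Nat.mul_pos hq hfac) ?_).symm
          rw [← h]
          ring
        exact ⟨h', h' ▸ h⟩
      have hset : {f : V → V | (∃ r, IsRootedAt f r) ∧ mapType f = l ++ [s]} =
          {f | (∃ r, r ≠ m ∧ IsRootedAt f r) ∧ mapType f = l ++ [s]} := by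
        ext f
        constructor
        · rintro ⟨⟨r, hr⟩, ht⟩
          refine ⟨⟨r, ?_, hr⟩, ht⟩
          rintro rfl
          rw [mapType_of_isRootedAt_max hmax hr, ← List.nil_append [Nat.card V]] at ht
          exact hl' (List.append_inj_left' ht rfl).symm
        · rintro ⟨⟨r, -, hr⟩, ht⟩
          exact ⟨⟨r, hr⟩, ht⟩
      rw [hset, ncard_rooted_ne m (fun f : V → V => mapType f = l ++ [s])
        (fun S (f : {x // x ∉ S} → {x // x ∉ S}) => mapType f = l ∧ S.card = s)
        (fun S hm g f p hg => by
          rw [mapType_glue hmax hm hg]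
          constructor
          · intro h
            exact ⟨List.append_inj_left' h rfl, by simpa using List.append_inj_right' h rfl⟩
          · rintro ⟨h, h'⟩
            rw [h, h'])
        (fun j => j ^ (j - 2)) (fun j => if j = s then N else 0)
        (fun S _ hm => ncard_isRootedAt _ _ (Fintype.card_coe S))
        (fun S _ hm => by
          by_cases h : S.card = s
          · simp only [h, and_true, if_true]
            exact (hN S h).1
          · simp [h])]
      -- Any one `S` of size `s` serves to extract the equation satisfied by `N`.
      obtain ⟨S, -, hS⟩ := Finset.exists_subset_card_eq (s := (Finset.univ : Finset V)) (n := s)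
        (by rw [Finset.card_univ]; omega)
      have hNq := (hN S hS).2
      clear_value N
      obtain ⟨i, rfl⟩ : ∃ i, s = i + 1 := ⟨s - 1, by omega⟩
      -- The index counts the elements of `S` other than `m`, so only `s - 1 = i` contributes.
      rw [Finset.sum_eq_single i (fun j _ hj => by simp [hj])
        (fun h => absurd (Finset.mem_range.2 (by omega)) h), if_pos rfl, hn]
      have e1 : l.sum + (i + 1) - 1 = l.sum + i := rfl
      have e2 : i + 1 - 2 = i - 1 := by omega
      have e3 : (i + 1) * (i + 1) ^ (i - 1) = (i + 1) ^ i := by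
        rcases i with _ | i
        · simp
        · rw [← pow_succ']; rfl
      have e4 := Nat.add_choose_mul_factorial_mul_factorial l.sum i
      rw [e1, e2, Nat.add_sub_cancel, Nat.add_sub_cancel, ← e3, ← Nat.add_assoc,
        Nat.factorial_succ (l.sum + i), ← e4, Nat.factorial_succ i]
      linear_combination (l.sum + i + 1) * (l.sum + i).choose i * (i + 1) ^ (i - 1) *
        ((i + 1) * i !) * hNq

/-! ### From parent maps to labelled trees -/

/-- The graph with an edge between every node and its image under `f`. -/
def parentGraph {V : Type*} (f : V → V) : SimpleGraph V := SimpleGraph.fromRel fun v p => f v = p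

theorem parentGraph_adj {V : Type*} {f : V → V} {u v : V} :
    (parentGraph f).Adj u v ↔ u ≠ v ∧ (f u = v ∨ f v = u) := Iff.rfl

namespace IsRootedAt

variable {V : Type*} {f : V → V} {r : V}

theorem apply_ne (h : IsRootedAt f r) {v : V} (hv : v ≠ r) : f v ≠ v := fun hf =>
  hv (h.eq_root_of_iterate_eq one_pos hf)

theorem reachable_root (h : IsRootedAt f r) (v : V) : (parentGraph f).Reachable v r := by
  obtain ⟨k, hk⟩ := h.2 v
  induction k generalizing v with
  | zero => exact hk ▸ SimpleGraph.Reachable.refl _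
  | succ k ih =>
    by_cases hv : f v = v
    · exact ih v (by rwa [Function.iterate_succ_apply, hv] at hk)
    · exact (SimpleGraph.Adj.reachable
        (parentGraph_adj.2 ⟨Ne.symm hv, Or.inl rfl⟩)).trans (ih (f v) hk)

theorem connected (h : IsRootedAt f r) : (parentGraph f).Connected :=
  SimpleGraph.connected_iff_exists_forall_reachable _ |>.2
    ⟨r, fun v => (h.reachable_root v).symm⟩

/-- The graph is connected, and the non-root nodes `v` map onto the edges by `s(v, f v)`, so there
are at most `|V| - 1` edges. -/
theorem isTree [Finite V] (h : IsRootedAt f r) : (parentGraph f).IsTree := by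
  classical
  refine SimpleGraph.isTree_iff_connected_and_card.2 ⟨h.connected, le_antisymm ?_
    h.connected.card_vert_le_card_edgeSet_add_one⟩
  have hV : Nat.card V = Nat.card {v // v ≠ r} + 1 := by
    have := Fintype.ofFinite V
    rw [Nat.card_eq_fintype_card, Nat.card_eq_fintype_card, Fintype.card_subtype_compl,
      Fintype.card_subtype_eq]
    have := Fintype.card_pos_iff.2 ⟨r⟩
    omega
  rw [hV]
  refine Nat.add_le_add_right (Nat.card_le_card_of_surjective
    (fun v : {v // v ≠ r} => (⟨s(v.1, f v), ?_⟩ : (parentGraph f).edgeSet)) ?_) 1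
  · exact parentGraph_adj.2 ⟨(h.apply_ne v.2).symm, Or.inl rfl⟩
  · rintro ⟨e, he⟩
    induction e using Sym2.ind with
    | _ a b =>
      obtain ⟨hab, hf | hf⟩ := parentGraph_adj.1 he
      · refine ⟨⟨a, ?_⟩, Subtype.ext (by simp [hf])⟩
        rintro rfl
        exact hab (h.1.symm.trans hf)
      · refine ⟨⟨b, ?_⟩, Subtype.ext (by simp [hf, Sym2.eq_swap])⟩
        rintro rfl
        exact hab (hf.symm.trans h.1)

/-- A path to the root never steps down to a child: the rest of the path, being the orbit of that
child, would return to the starting node. -/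
theorem mem_support_iff (h : IsRootedAt f r) {v : V} (q : (parentGraph f).Walk v r)
    (hq : q.IsPath) (u : V) : u ∈ q.support ↔ ∃ k, f^[k] v = u := by
  suffices H : ∀ {v w : V} (q : (parentGraph f).Walk v w), w = r → q.IsPath → ∀ u,
      u ∈ q.support ↔ ∃ k, f^[k] v = u from H q rfl hq u
  intro v w q hw hq
  induction q with
  | nil =>
    subst hw
    intro u
    simp [h.iterate_root, eq_comm]
  | @cons a b c hab q ih =>
    intro u
    rw [SimpleGraph.Walk.cons_isPath_iff] at hq
    have ih := ih hw hq.1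
    obtain ⟨-, hf | hf⟩ := parentGraph_adj.1 hab
    · rw [SimpleGraph.Walk.support_cons, List.mem_cons, ih, ← hf]
      constructor
      · rintro (rfl | ⟨k, hk⟩)
        exacts [⟨0, rfl⟩, ⟨k + 1, hk⟩]
      · rintro ⟨_ | k, hk⟩
        exacts [Or.inl hk.symm, Or.inr ⟨k, hk⟩]
    · exact absurd ((ih a).2 ⟨1, hf⟩) hq.2

/-- The rooted tree with parent map `f`. -/
def toTree [Finite V] (h : IsRootedAt f r) : RootedLabelledTree V where
  graph := parentGraph f
  isTree := h.isTree
  root := r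

theorem forall_path_iff [Finite V] (h : IsRootedAt f r) (v : V) (P : V → Prop) :
    (∀ q : h.toTree.graph.Walk v h.toTree.root, q.IsPath → ∀ u ∈ q.support, P u) ↔
      ∀ k, P (f^[k] v) := by
  obtain ⟨q, hq⟩ := (h.reachable_root v).exists_isPath
  constructor
  · exact fun H k => H q hq _ ((h.mem_support_iff q hq _).2 ⟨k, rfl⟩)
  · intro H q hq u hu
    obtain ⟨k, rfl⟩ := (h.mem_support_iff q hq u).1 hu
    exact H k

theorem isParent_iff [Finite V] (h : IsRootedAt f r) {p v : V} :
    h.toTree.IsParent p v ↔ v ≠ r ∧ f v = p := by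
  obtain ⟨q, hq⟩ := (h.reachable_root v).exists_isPath
  constructor
  · rintro ⟨hadj, hp⟩
    obtain ⟨k, hk⟩ := (h.mem_support_iff q hq p).1 (hp q hq)
    obtain ⟨hne, hf | hf⟩ := parentGraph_adj.1 hadj
    · have hpr : p = r := h.eq_root_of_iterate_eq (Nat.succ_pos k)
        (by rw [Function.iterate_succ_apply, hf, hk])
      subst hpr
      exact absurd (h.1.symm.trans hf) hne
    · refine ⟨?_, hf⟩
      rintro rfl
      exact hne (hf.symm.trans h.1)
  · rintro ⟨hv, rfl⟩
    exact ⟨parentGraph_adj.2 ⟨h.apply_ne hv, Or.inr rfl⟩,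
      fun q hq => (h.mem_support_iff q hq _).2 ⟨1, rfl⟩⟩

theorem eq_of_toTree_eq [Finite V] (h : IsRootedAt f r) {f' : V → V} {r' : V}
    (h' : IsRootedAt f' r') (he : h.toTree = h'.toTree) : f = f' := by
  have hr : r = r' := congrArg RootedLabelledTree.root he
  subst hr
  funext v
  by_cases hv : v = r
  · rw [hv, h.1, h'.1]
  · have := h.isParent_iff.2 ⟨hv, rfl⟩
    rw [he] at this
    exact (h'.isParent_iff.1 this).2.symm

variable [LinearOrder V] [Finite V]

theorem isRecord_iff (h : IsRootedAt f r) {v : V} : h.toTree.IsRecord v ↔ IsMapRecord f v :=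
  h.forall_path_iff v (· ≤ v)

theorem bonsaiForest_adj (h : IsRootedAt f r) {u v : V} :
    h.toTree.bonsaiForest.Adj u v ↔
      f u = v ∧ ¬ IsMapRecord f u ∨ f v = u ∧ ¬ IsMapRecord f v := by
  have hroot : IsMapRecord f r := fun k => (h.iterate_root k).le
  have hne : ∀ {w}, ¬ IsMapRecord f w → w ≠ r := fun hw hr => hw (hr ▸ hroot)
  -- This prevents the edge above a non-record from also being the deleted edge above its other end.
  have hcyc : ∀ {a b}, f a = b → f b = a → a = r := fun hab hba =>
    h.eq_root_of_iterate_eq two_pos (show f (f _) = _ by rw [hab, hba])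
  have key : ∀ {a b}, f a = b → ¬ IsMapRecord f a → h.toTree.bonsaiForest.Adj a b := by
    rintro a b hab ha
    rw [RootedLabelledTree.bonsaiForest, SimpleGraph.deleteEdges_adj]
    refine ⟨parentGraph_adj.2 ⟨fun e => h.apply_ne (hne ha) (hab.trans e.symm), Or.inl hab⟩, ?_⟩
    rintro ⟨p, w, hw, hp, he⟩
    rw [h.isRecord_iff] at hw
    rw [h.isParent_iff] at hp
    rcases Sym2.eq_iff.1 he with ⟨rfl, rfl⟩ | ⟨rfl, rfl⟩
    · exact hne ha (hcyc hab hp.2)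
    · exact ha hw
  constructor
  · intro hadj
    rw [RootedLabelledTree.bonsaiForest, SimpleGraph.deleteEdges_adj] at hadj
    obtain ⟨hadj, hdel⟩ := hadj
    obtain ⟨huv, hf | hf⟩ := parentGraph_adj.1 hadj
    · refine Or.inl ⟨hf, fun hu => hdel ⟨v, u, h.isRecord_iff.2 hu, h.isParent_iff.2 ⟨?_, hf⟩,
        Sym2.eq_swap⟩⟩
      rintro rfl
      exact huv (h.1.symm.trans hf)
    · refine Or.inr ⟨hf, fun hv => hdel ⟨u, v, h.isRecord_iff.2 hv, h.isParent_iff.2 ⟨?_, hf⟩,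
        rfl⟩⟩
      rintro rfl
      exact huv (hf.symm.trans h.1)
  · rintro (⟨hf, hu⟩ | ⟨hf, hv⟩)
    · exact key hf hu
    · exact (key hf hv).symm

theorem isBonsaiRoot_iff (h : IsRootedAt f r) {v : V} :
    h.toTree.IsBonsaiRoot v ↔ IsMapRecord f v := by
  have hroot : IsMapRecord f r := fun k => (h.iterate_root k).le
  constructor
  · intro H
    by_contra hv
    have hvr : v ≠ r := fun hr => hv (hr ▸ hroot)
    exact H (f v) (h.isParent_iff.2 ⟨hvr, rfl⟩) (h.bonsaiForest_adj.2 (Or.inr ⟨rfl, hv⟩))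
  · intro hv p hp hadj
    obtain ⟨hvr, hfv⟩ := h.isParent_iff.1 hp
    rcases h.bonsaiForest_adj.1 hadj with ⟨hf, -⟩ | ⟨-, hn⟩
    · exact hvr (h.eq_root_of_iterate_eq two_pos (show f (f v) = v by rw [hfv, hf]))
    · exact hn hv

theorem reachable_of_isOrbitTop (h : IsRootedAt f r) {v t : V} (ht : IsOrbitTop f v t) :
    h.toTree.bonsaiForest.Reachable v t := by
  obtain ⟨⟨k, hk⟩, hle⟩ := ht
  induction k generalizing v with
  | zero => exact hk ▸ SimpleGraph.Reachable.refl _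
  | succ k ih =>
    by_cases hv : IsMapRecord f v
    · obtain rfl : v = t := le_antisymm (hle 0) (hk ▸ hv (k + 1))
      exact SimpleGraph.Reachable.refl _
    · exact (SimpleGraph.Adj.reachable (h.bonsaiForest_adj.2 (Or.inl ⟨rfl, hv⟩))).trans
        (ih (fun j => hle (j + 1)) hk)

theorem isOrbitTop_iff_of_reachable (h : IsRootedAt f r) {u v t : V}
    (huv : h.toTree.bonsaiForest.Reachable u v) : IsOrbitTop f u t ↔ IsOrbitTop f v t := by
  obtain ⟨q⟩ := huv
  induction q with
  | nil => rfl
  | cons hadj _ ih =>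
    rw [← ih]
    rcases h.bonsaiForest_adj.1 hadj with ⟨rfl, hn⟩ | ⟨rfl, hn⟩
    · exact (isOrbitTop_apply_iff hn).symm
    · exact isOrbitTop_apply_iff hn

/-- The orbit maximum is invariant on components, and climbing from a node inside the forest ends at
its orbit maximum. -/
theorem supp_connectedComponentMk (h : IsRootedAt f r) {t : V} (ht : IsMapRecord f t) :
    (h.toTree.bonsaiForest.connectedComponentMk t).supp = {v | IsOrbitTop f v t} := by
  ext v
  rw [SimpleGraph.ConnectedComponent.mem_supp_iff, SimpleGraph.ConnectedComponent.eq]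
  exact ⟨fun hv => (h.isOrbitTop_iff_of_reachable hv).2 ⟨⟨0, rfl⟩, ht⟩,
    fun hv => h.reachable_of_isOrbitTop hv⟩

end IsRootedAt

theorem bonsaiType_toTree {V : Type*} [Fintype V] [LinearOrder V] {f : V → V} {r : V}
    (h : IsRootedAt f r) : h.toTree.bonsaiType = mapType f := by
  classical
  have hrec : Finset.univ.filter h.toTree.IsBonsaiRoot =
      (Set.toFinite {r | IsMapRecord f r}).toFinset := by
    ext v
    simp [h.isBonsaiRoot_iff]
  rw [RootedLabelledTree.bonsaiType, RootedLabelledTree.bonsaiSequence, List.map_map, mapType,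
    ← hrec]
  have hc : ∀ (p q : DecidablePred h.toTree.IsBonsaiRoot),
      @Finset.filter V h.toTree.IsBonsaiRoot p Finset.univ =
        @Finset.filter V h.toTree.IsBonsaiRoot q Finset.univ := fun p q => by congr!
  rw [hc _ fun a => Classical.propDecidable _]
  refine List.map_congr_left fun t ht => ?_
  have ht' : IsMapRecord f t := by simpa [h.isBonsaiRoot_iff] using ht
  rw [Function.comp_apply, h.supp_connectedComponentMk ht']

/-- Let the parent be a neighbour closer to the root. The resulting graph is connected and contained
in the tree, hence equal to it because a tree is minimally connected. -/
theorem RootedLabelledTree.exists_toTree_eq {V : Type*} [Finite V] (T : RootedLabelledTree V) :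
    ∃ (f : V → V) (r : V) (h : IsRootedAt f r), h.toTree = T := by
  classical
  have hstep : ∀ v, v ≠ T.root → ∃ w, T.graph.Adj v w ∧
      T.graph.dist w T.root < T.graph.dist v T.root := by
    intro v hv
    obtain ⟨q, hq⟩ := T.isTree.connected.exists_walk_length_eq_dist v T.root
    cases q with
    | nil => exact absurd rfl hv
    | cons hadj q =>
      refine ⟨_, hadj, ?_⟩
      have := SimpleGraph.dist_le q
      rw [SimpleGraph.Walk.length_cons] at hq
      omega
  choose! par hadj hdist using hstep
  let f : V → V := fun v => if v = T.root then v else par v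
  have hf : IsRootedAt f T.root := by
    refine ⟨by simp [f], fun v => ?_⟩
    induction hd : T.graph.dist v T.root using Nat.strong_induction_on generalizing v with
    | _ d ih =>
      by_cases hv : v = T.root
      · exact ⟨0, hv⟩
      · obtain ⟨k, hk⟩ := ih _ (hd ▸ hdist v hv) (par v) rfl
        refine ⟨k + 1, ?_⟩
        rw [Function.iterate_succ_apply]
        simpa [f, hv] using hk
  refine ⟨f, T.root, hf, RootedLabelledTree.ext ?_ rfl⟩
  have hle : parentGraph f ≤ T.graph := by
    have key : ∀ a b, a ≠ b → f a = b → T.graph.Adj a b := by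
      intro a b hab hf
      by_cases ha : a = T.root
      · exact absurd (by simpa [f, ha] using hf) (ha ▸ hab)
      · have := hadj a ha
        simp only [f, ha, if_false] at hf
        rwa [hf] at this
    intro a b hab
    obtain ⟨hne, h | h⟩ := parentGraph_adj.1 hab
    · exact key a b hne h
    · exact (key b a hne.symm h).symm
  exact le_antisymm hle
    ((SimpleGraph.isTree_iff_minimal_connected.1 T.isTree).le_of_le hf.connected hle)

theorem ncard_bonsaiType {V : Type*} [Fintype V] [LinearOrder V] (l : List ℕ) :
    {T : RootedLabelledTree V | T.bonsaiType = l}.ncard =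
      {f : V → V | (∃ r, IsRootedAt f r) ∧ mapType f = l}.ncard := by
  symm
  -- Choosing the root from its existence is harmless, since it is unique.
  refine Set.ncard_congr (fun f hf => hf.1.choose_spec.toTree) ?_ ?_ ?_
  · intro f hf
    exact (bonsaiType_toTree _).trans hf.2
  · intro f f' hf hf' h
    exact hf.1.choose_spec.eq_of_toTree_eq hf'.1.choose_spec h
  · intro T hT
    obtain ⟨f, r, h, rfl⟩ := T.exists_toTree_eq
    have hex : ∃ r, IsRootedAt f r := ⟨_, h⟩
    refine ⟨f, ⟨hex, (bonsaiType_toTree h).symm.trans hT⟩, ?_⟩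
    exact RootedLabelledTree.ext rfl (h.root_unique hex.choose_spec)

/-! ### The formula and its symmetry -/

open Nat in
theorem numRootedTreesOfType_mul {n : ℕ} (hn : 1 ≤ n) (t : Composition n) :
    n * numRootedTreesOfType t * (t.blocks.map (· !)).prod =
      n ! * (t.blocks.map fun i => i ^ (i - 1)).prod := by
  have h := ncard_mapType t.blocks (fun h => by have := t.blocks_sum; simp [h] at this; omega)
    (fun i hi => t.blocks_pos hi) (V := Fin n) (by rw [t.blocks_sum, Fintype.card_fin])
  rw [t.blocks_sum] at h
  rw [numRootedTreesOfType, ncard_bonsaiType]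
  exact h

theorem prod_map_blocks {n : ℕ} (t : Composition n) (F : ℕ → ℕ) :
    (t.blocks.map F).prod = ∏ i, F (t.blocksFun i) := by
  rw [← t.ofFn_blocksFun, List.map_ofFn, List.prod_ofFn]
  rfl

theorem mainTheorem7 (n : ℕ) (hn : 1 ≤ n) (t : Composition n) :
    (numRootedTreesOfType t : ℚ) =
        1 / (n : ℚ) * (Nat.multinomial Finset.univ t.blocksFun : ℚ) *
          ∏ i : Fin t.length, (t.blocksFun i : ℚ) ^ (t.blocksFun i - 1) ∧
      ∀ t' : Composition n, (t'.blocks : Multiset ℕ) = (t.blocks : Multiset ℕ) →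
        numRootedTreesOfType t' = numRootedTreesOfType t := by
  have hpos : 0 < (t.blocks.map Nat.factorial).prod := by
    rw [prod_map_blocks]
    exact Finset.prod_pos fun i _ => Nat.factorial_pos _
  constructor
  · have h := numRootedTreesOfType_mul hn t
    have hm := Nat.multinomial_spec Finset.univ t.blocksFun
    rw [t.sum_blocksFun] at hm
    rw [← prod_map_blocks] at hm
    rw [← hm] at h
    have h' : n * numRootedTreesOfType t = Nat.multinomial Finset.univ t.blocksFun *
        ∏ i : Fin t.length, t.blocksFun i ^ (t.blocksFun i - 1) := by
      rw [← prod_map_blocks t fun i => i ^ (i - 1)]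
      refine Nat.eq_of_mul_eq_mul_left hpos ?_
      linarith
    have hn0 : (n : ℚ) ≠ 0 := by exact_mod_cast (by omega : n ≠ 0)
    have hq : (n : ℚ) * numRootedTreesOfType t = Nat.multinomial Finset.univ t.blocksFun *
        ∏ i : Fin t.length, (t.blocksFun i : ℚ) ^ (t.blocksFun i - 1) := by exact_mod_cast h'
    rw [mul_assoc, ← hq]
    field_simp
  · intro t' ht'
    have hperm : t'.blocks.Perm t.blocks := Multiset.coe_eq_coe.1 ht'
    have h := numRootedTreesOfType_mul hn t
    have h' := numRootedTreesOfType_mul hn t'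
    rw [(hperm.map _).prod_eq, (hperm.map _).prod_eq, ← h] at h'
    exact Nat.eq_of_mul_eq_mul_left (by omega) (Nat.eq_of_mul_eq_mul_right hpos h')
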